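/- Let $\Lambda$ be an artin algebra, i.e. an algebra over a commutative artinian ring $R$ that is finitely generated as an $R$-module, and let $\mathscr{A}=\mathrm{mod}\text{-}\Lambda$ be the category of finitely generated right $\Lambda$-modules. Let $\mathscr{C},\mathscr{T},\mathscr{F}$ be full subcategories of $\mathscr{A}$, with $\mathscr{C}$ closed under direct summands (in particular under isomorphisms). For a subcategory $\mathscr{X}$, a left $\mathscr{X}$-approximation of $M$ is a morphism $f\colon M\to X$ with $X\in\mathscr{X}$ through which every morphism from $M$ to an object of $\mathscr{X}$ factors; right $\mathscr{X}$-approximations are defined dually. $\mathscr{X}$ is contravariantly finite if every object of $\mathscr{A}$ has a right $\mathscr{X}$-approximation. The pair $(\mathscr{T},\mathscr{F})$ is a torsion pair if $\mathrm{Hom}_\Lambda(\mathscr{T},\mathscr{F})=0$ and for every $M\in\mathscr{A}$ there is a short exact sequence $0\to tM\to M\to fM\to 0$ with $tM\in\mathscr{T}$ and $fM\in\mathscr{F}$. The triple $(\mathscr{C},\mathscr{T},\mathscr{F})$ is called a $\tau$-cotorsion torsion triple if $(\mathscr{T},\mathscr{F})$ is a torsion pair and 1. $\mathscr{C}={}^{\perp_1}\mathscr{T}:=\{M\in\mathscr{A}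 : \mathrm{Ext}^1_\Lambda(M,T)=0 \text{ for all } T\in\mathscr{T}\}$; 2. for every projective $P\in\mathscr{A}$ there is an exact sequence $P\xrightarrow{f}D\to C\to 0$ with $D\in\mathscr{C}\cap\mathscr{T}$, $C\in\mathscr{C}$ and $f$ a left $\mathscr{T}$-approximation; 3. $\mathscr{C}\cap\mathscr{T}$ is contravariantly finite in $\mathscr{A}$. It is called a left weak cotorsion torsion triple (in the sense of Buan and Zhou) if $(\mathscr{T},\mathscr{F})$ is a torsion pair and 1. $\mathrm{Ext}^1_\Lambda(C,T)=0$ for all $C\in\mathscr{C}$ and $T\in\mathscr{T}$; 2. for every $M\in\mathscr{A}$ there are exact sequences $M\xrightarrow{f}D\to C\to 0$ and $0\to D'\to C'\xrightarrow{g}M\to 0$ with $C,C'\in\mathscr{C}$, $D,D'\in\mathscr{T}$, $f$ a left $\mathscr{T}$-approximation of $M$ and $g$ a right $\mathscr{C}$-approximation of $M$. Then $(\mathscr{C},\mathscr{T},\mathscr{F})$ is a $\tau$-cotorsion torsion triple if and only if it is a left weak cotorsion torsion triple. -/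

import Mathlib

open CategoryTheory CategoryTheory.Limits

universe w v u

namespace TauTriple

/-- If `R` is a commutative artinian ring and `Λ` is an `R`-algebra which is finitely generated as
an `R`-module (that is, `Λ` is an artin `R`-algebra), then `Λᵐᵒᵖ` is left noetherian, so that
finitely generated right `Λ`-modules form an abelian category. -/
theorem isNoetherianRing_op (R : Type w) [CommRing R] [IsArtinianRing R]
    (Λ : Type u) [Ring Λ] [Algebra R Λ] [Module.Finite R Λ] : IsNoetherianRing Λᵐᵒᵖ :=
  haveI : Module.Finite R Λᵐᵒᵖ := Module.Finite.equiv (MulOpposite.opLinearEquiv R : Λ ≃ₗ[R] Λᵐᵒᵖ)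
  IsNoetherianRing.of_finite R Λᵐᵒᵖ

section Approximations

variable {A : Type u} [Category.{v} A]

/-- `f : X₀ ⟶ M` is a right `X`-approximation of `M`: `X₀` is in `X` and every morphism to `M` from
an object of `X` factors through `f`. -/
def IsRightApproximation (X : ObjectProperty A) {X₀ M : A} (f : X₀ ⟶ M) : Prop :=
  X X₀ ∧ ∀ X' : A, X X' → ∀ g : X' ⟶ M, ∃ h : X' ⟶ X₀, h ≫ f = g

/-- `f : M ⟶ X₀` is a left `X`-approximation of `M`: `X₀` is in `X` and every morphism from `M` to
an object of `X` factors through `f`. -/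
def IsLeftApproximation (X : ObjectProperty A) {M X₀ : A} (f : M ⟶ X₀) : Prop :=
  X X₀ ∧ ∀ X' : A, X X' → ∀ g : M ⟶ X', ∃ h : X₀ ⟶ X', f ≫ h = g

/-- Every object admits a right `X`-approximation. -/
def IsContravariantlyFinite (X : ObjectProperty A) : Prop :=
  ∀ M : A, ∃ (X₀ : A) (f : X₀ ⟶ M), IsRightApproximation X f

end Approximations

section Abelian

variable {A : Type u} [Category.{v} A] [Abelian A]

/-- `Ext¹(M, N) = 0` in the abelian category `A`. -/
def ExtOneVanishes (M N : A) : Prop :=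
  letI : HasExt.{max u v} A := HasExt.standard A
  ∀ e : Abelian.Ext.{max u v} M N 1, e = 0

/-- The subcategory `{}^{⊥₁} D` of all objects `M` with `Ext¹(M, D) = 0`. -/
def leftPerpOne (D : ObjectProperty A) : ObjectProperty A :=
  fun M => ∀ N : A, D N → ExtOneVanishes M N

/-- Torsion pairs: `Hom(T, F) = 0` and every object `M` is in the middle of a short exact sequence
`0 ⟶ t ⟶ M ⟶ f ⟶ 0` with `t` in `T` and `f` in `F`. -/
structure IsTorsionPair (T F : ObjectProperty A) : Prop where
  hom_eq_zero : ∀ X Y : A, T X → F Y → ∀ g : X ⟶ Y, g = 0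
  exists_shortExact : ∀ M : A, ∃ (t f : A) (i : t ⟶ M) (p : M ⟶ f) (hip : i ≫ p = 0),
    (ShortComplex.mk i p hip).ShortExact ∧ T t ∧ F f

/-- `τ`-cotorsion pairs. -/
structure IsTauCotorsionPair (C D : ObjectProperty A) : Prop where
  eq_leftPerpOne : C = leftPerpOne D
  /-- an exact sequence `P ⟶ D₀ ⟶ C₀ ⟶ 0` for every projective object `P` -/
  exists_exact : ∀ P : A, Projective P →
    ∃ (D₀ C₀ : A) (f : P ⟶ D₀) (p : D₀ ⟶ C₀) (hfp : f ≫ p = 0),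
      (ShortComplex.mk f p hfp).Exact ∧ Epi p ∧
      (C D₀ ∧ D D₀) ∧ C C₀ ∧ IsLeftApproximation D f
  contravariantlyFinite : IsContravariantlyFinite (C ⊓ D)

/-- `τ`-cotorsion torsion triples (`τ`-triples). -/
structure IsTauCotorsionTorsionTriple (C T F : ObjectProperty A) : Prop where
  tauCotorsionPair : IsTauCotorsionPair C T
  torsionPair : IsTorsionPair T F

/-- Left weak cotorsion pairs, in the sense of Buan and Zhou. -/
structure IsLeftWeakCotorsionPair (C D : ObjectProperty A) : Prop where
  ext_eq_zero : ∀ X Y : A, C X → D Y → ExtOneVanishes X Y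
  /-- an exact sequence `M ⟶ D₀ ⟶ C₀ ⟶ 0` for every object `M` -/
  exists_exact : ∀ M : A, ∃ (D₀ C₀ : A) (f : M ⟶ D₀) (p : D₀ ⟶ C₀) (hfp : f ≫ p = 0),
    (ShortComplex.mk f p hfp).Exact ∧ Epi p ∧ D D₀ ∧ C C₀ ∧ IsLeftApproximation D f
  /-- a short exact sequence `0 ⟶ D₁ ⟶ C₁ ⟶ M ⟶ 0` for every object `M` -/
  exists_shortExact : ∀ M : A, ∃ (D₁ C₁ : A) (i : D₁ ⟶ C₁) (g : C₁ ⟶ M) (hig : i ≫ g = 0),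
    (ShortComplex.mk i g hig).ShortExact ∧ D D₁ ∧ C C₁ ∧ IsRightApproximation C g

/-- Left weak cotorsion torsion triples, in the sense of Buan and Zhou. -/
structure IsLeftWeakCotorsionTorsionTriple (C T F : ObjectProperty A) : Prop where
  leftWeakCotorsionPair : IsLeftWeakCotorsionPair C T
  torsionPair : IsTorsionPair T F

end Abelian

end TauTriple

namespace TauTriple

/-! The key is `leftPerpOne_of_isPushout`: pushing out a left `T`-approximation `K ⟶ D`, with
cokernel in `{}^{⊥₁} T`, along a map `K ⟶ P` to a projective gives an object of `{}^{⊥₁} T`. With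
`K` the kernel of an epimorphism `P ⟶ M`, the pushout yields the special right `C`-approximation of
`M`. With `K = P` and the identity map, it shows that `D` itself is in `C`. Left approximations pass
from projectives to their quotients by pushout, and right `C ⊓ T`-approximations come from right
`C`-approximations of torsion subobjects. Since `T` is not assumed closed under isomorphisms,
closure properties are stated for `T.isoClosure`. -/

theorem IsLeftApproximation.exists_factor {A : Type u} [Category.{v} A]
    {T : ObjectProperty A} {K D X : A} {f : K ⟶ D}
    (hf : IsLeftApproximation T f)
    (hX : T.isoClosure X) (g : K ⟶ X) : ∃ k : D ⟶ X, f ≫ k = g := by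
  obtain ⟨t, ht, ⟨e⟩⟩ := hX
  obtain ⟨k, hk⟩ := hf.2 t ht (g ≫ e.hom)
  exact ⟨k ≫ e.inv, by rw [reassoc_of% hk, e.hom_inv_id, Category.comp_id]⟩

/-! ### Extensions and pushouts in abelian categories. -/

section Abelian

variable {A : Type u} [Category.{v} A] [Abelian A]

/-- If `Ext¹(X, S.X₁) = 0`, every morphism `X ⟶ S.X₃` lifts along the epimorphism of the short exact
sequence `S`. -/
theorem ExtOneVanishes.exists_lift {X : A} {S : ShortComplex A} (hS : S.ShortExact)
    (h : ExtOneVanishes X S.X₁) (a : X ⟶ S.X₃) : ∃ b : X ⟶ S.X₂, b ≫ S.g = a := by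
  let : HasExt.{max u v} A := HasExt.standard A
  obtain ⟨x, hx⟩ := Abelian.Ext.covariant_sequence_exact₃ X hS (Abelian.Ext.mk₀ a) (zero_add 1)
    (h _)
  obtain ⟨b, rfl⟩ := Abelian.Ext.addEquiv₀.symm.surjective x
  refine ⟨b, Abelian.Ext.addEquiv₀.symm.injective ?_⟩
  simpa using hx

theorem exists_cokernel_of_isPushout {K P D E C₀ : A} {i : K ⟶ P} {f : K ⟶ D} {u : P ⟶ E}
    {v : D ⟶ E} (sq : IsPushout i f u v) {p : D ⟶ C₀} (hfp : f ≫ p = 0)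
    (hex : (ShortComplex.mk f p hfp).Exact) [Epi p] :
    ∃ (c : E ⟶ C₀) (hc : u ≫ c = 0), v ≫ c = p ∧ Epi c ∧ (ShortComplex.mk u c hc).Exact := by
  have hw : i ≫ (0 : P ⟶ C₀) = f ≫ p := by rw [hfp, comp_zero]
  have hu : u ≫ sq.desc 0 p hw = 0 := sq.inl_desc _ _ _
  have hv : v ≫ sq.desc 0 p hw = p := sq.inr_desc _ _ _
  have hepi : Epi (sq.desc 0 p hw) := by
    have : Epi (v ≫ sq.desc 0 p hw) := by rw [hv]; infer_instance
    exact epi_of_epi v _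
  refine ⟨sq.desc 0 p hw, hu, hv, hepi, ?_⟩
  have : Epi (ShortComplex.mk f p hfp).g := ‹Epi p›
  refine ShortComplex.exact_of_g_is_cokernel _ (CokernelCofork.IsColimit.ofπ' _ _ ?_)
  intro Z k hk
  have hfk : f ≫ v ≫ k = 0 := by rw [← sq.w_assoc, hk, comp_zero]
  refine ⟨hex.desc (v ≫ k) hfk, sq.hom_ext ?_ ?_⟩
  · dsimp
    rw [reassoc_of% hu, hk, zero_comp]
  · dsimp
    rw [reassoc_of% hv]
    exact hex.g_desc (v ≫ k) hfk

theorem shortExact_of_isPushout {S : ShortComplex A} (hS : S.ShortExact) {D E : A}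
    {f : S.X₁ ⟶ D} {u : S.X₂ ⟶ E} {v : D ⟶ E} (sq : IsPushout S.f f u v) :
    ∃ (c : E ⟶ S.X₃) (hc : v ≫ c = 0), u ≫ c = S.g ∧ (ShortComplex.mk v c hc).ShortExact := by
  have := hS.epi_g
  have := hS.mono_f
  obtain ⟨c, hc, huc, hepi, hex⟩ := exists_cokernel_of_isPushout sq.flip S.zero hS.exact
  have : Mono v := (MorphismProperty.monomorphisms A).of_isPushout sq.flip ‹Mono S.f›
  exact ⟨c, hc, huc, ⟨hex⟩⟩

/-- `Ext¹(E, X) = 0` as soon as all extensions of `E` by `X` split. -/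
theorem extOneVanishes_of_forall_split [EnoughProjectives A] {E X : A}
    (h : ∀ (Y : A) (j : X ⟶ Y) (q : Y ⟶ E) (hjq : j ≫ q = 0),
      (ShortComplex.mk j q hjq).ShortExact → ∃ s : E ⟶ Y, s ≫ q = 𝟙 E) :
    ExtOneVanishes E X := by
  let : HasExt.{max u v} A := HasExt.standard A
  intro e
  let S : ShortComplex A := ShortComplex.mk (kernel.ι (Projective.π E)) (Projective.π E)
    (kernel.condition _)
  have hS : S.ShortExact := ⟨ShortComplex.exact_of_f_is_kernel _ (kernelIsKernel _)⟩
  obtain ⟨x, rfl⟩ := Abelian.Ext.contravariant_sequence_exact₃ hS X e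
    (Abelian.Ext.eq_zero_of_projective _) (add_zero 1)
  obtain ⟨φ, rfl⟩ := Abelian.Ext.addEquiv₀.symm.surjective x
  have sq := IsPushout.of_hasPushout S.f φ
  obtain ⟨q, hjq, -, hq⟩ := shortExact_of_isPushout hS sq
  obtain ⟨s, hs⟩ := h _ _ q hjq hq
  let σ := ShortComplex.Splitting.ofExactOfSection _ hq.exact s hs hq.mono_f
  -- The class `e` is the pushout of the projective presentation along `φ`; the retraction extends
  -- `φ` over the projective, which kills `e`.
  have hφ : φ = S.f ≫ pushout.inl S.f φ ≫ σ.r := by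
    have := σ.f_r
    dsimp at this
    rw [sq.w_assoc, this, Category.comp_id]
  change hS.extClass.comp (Abelian.Ext.mk₀ φ) _ = 0
  rw [hφ, ← Abelian.Ext.mk₀_comp_mk₀]
  exact hS.extClass_comp_assoc _

/-! ### Torsion pairs and the key pushout lemma. -/

variable {C T F : ObjectProperty A}

theorem IsTorsionPair.isoClosure_of_hom_eq_zero (h : IsTorsionPair T F) {M : A}
    (hM : ∀ Y : A, F Y → ∀ g : M ⟶ Y, g = 0) : T.isoClosure M := by
  obtain ⟨t, f, i, p, hip, hS, ht, hf⟩ := h.exists_shortExact M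
  have : Mono i := hS.mono_f
  have : Epi i := hS.exact.epi_f (hM f hf p)
  have : IsIso i := isIso_of_mono_of_epi i
  exact ⟨t, ht, ⟨(asIso i).symm⟩⟩

theorem IsTorsionPair.hom_eq_zero_of_isoClosure (h : IsTorsionPair T F) {X Y : A}
    (hX : T.isoClosure X) (hY : F Y) (g : X ⟶ Y) : g = 0 := by
  obtain ⟨t, ht, ⟨e⟩⟩ := hX
  rw [← cancel_epi e.inv, comp_zero]
  exact h.hom_eq_zero t Y ht hY _

theorem IsTorsionPair.isoClosure_of_epi (h : IsTorsionPair T F) {X Y : A} (hX : T X)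
    (p : X ⟶ Y) [Epi p] : T.isoClosure Y :=
  h.isoClosure_of_hom_eq_zero fun Z hZ g => by
    rw [← cancel_epi p, comp_zero]
    exact h.hom_eq_zero X Z hX hZ _

theorem IsTorsionPair.isoClosure_of_shortExact (h : IsTorsionPair T F) {S : ShortComplex A}
    (hS : S.ShortExact) (h₁ : T S.X₁) (h₃ : T S.X₃) : T.isoClosure S.X₂ :=
  h.isoClosure_of_hom_eq_zero fun Z hZ g => by
    have := hS.epi_g
    have hg : S.f ≫ g = 0 := h.hom_eq_zero _ _ h₁ hZ _
    rw [← hS.exact.g_desc g hg, h.hom_eq_zero _ _ h₃ hZ (hS.exact.desc g hg), comp_zero]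

theorem shortExact_pullback {X Y E D : A} {j : X ⟶ Y} {q : Y ⟶ E} {hjq : j ≫ q = 0}
    (hS : (ShortComplex.mk j q hjq).ShortExact) (w : D ⟶ E) :
    ∃ (l : X ⟶ pullback q w) (hl : l ≫ pullback.snd q w = 0),
      (ShortComplex.mk l (pullback.snd q w) hl).ShortExact := by
  have : Mono j := hS.mono_f
  have : Epi q := hS.epi_g
  have hw : j ≫ q = (0 : X ⟶ D) ≫ w := by rw [hjq, zero_comp]
  have hfst : pullback.lift j 0 hw ≫ pullback.fst q w = j := pullback.lift_fst _ _ _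
  have hsnd : pullback.lift j 0 hw ≫ pullback.snd q w = 0 := pullback.lift_snd _ _ _
  have : Mono (pullback.lift j 0 hw) := by
    have : Mono (pullback.lift j 0 hw ≫ pullback.fst q w) := by rw [hfst]; infer_instance
    exact mono_of_mono _ (pullback.fst q w)
  refine ⟨pullback.lift j 0 hw, hsnd, ⟨?_⟩⟩
  refine ShortComplex.exact_of_f_is_kernel _ (KernelFork.IsLimit.ofι' _ _ ?_)
  intro Z k hk
  dsimp at k hk
  have hk' : (k ≫ pullback.fst q w) ≫ q = 0 := by
    rw [Category.assoc, pullback.condition, reassoc_of% hk, zero_comp]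
  have : Mono (ShortComplex.mk j q hjq).f := ‹Mono j›
  refine ⟨hS.exact.lift _ hk', pullback.hom_ext ?_ ?_⟩
  · dsimp
    rw [Category.assoc, hfst]
    exact hS.exact.lift_f _ hk'
  · dsimp
    rw [Category.assoc, hsnd, hk, comp_zero]

/-- Let `f : K ⟶ D` be a left approximation by a torsion class `T` with cokernel in `{}^{⊥₁} T`. The
pushout of `f` along a morphism from `K` to a projective object is in `{}^{⊥₁} T`. -/
theorem leftPerpOne_of_isPushout [EnoughProjectives A] (h : IsTorsionPair T F)
    {K P D E C₀ : A} [Projective P] {i : K ⟶ P} {f : K ⟶ D} {a : P ⟶ E} {b : D ⟶ E}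
    (sq : IsPushout i f a b) {p : D ⟶ C₀} (hfp : f ≫ p = 0)
    (hex : (ShortComplex.mk f p hfp).Exact) [Epi p] (hC₀ : leftPerpOne T C₀)
    (hf : IsLeftApproximation T f) : leftPerpOne T E := by
  intro X hX
  refine extOneVanishes_of_forall_split fun Y j q hjq hS => ?_
  have : Epi q := hS.epi_g
  obtain ⟨c, hac, hbc, hepi, hexc⟩ := exists_cokernel_of_isPushout sq hfp hex
  obtain ⟨l, hl, hpb⟩ := shortExact_pullback hS b
  let α : P ⟶ Y := Projective.factorThru a q
  have hα : α ≫ q = a := Projective.factorThru_comp a q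
  -- The pullback of the extension along `b` is an extension of `D` by `X`, hence torsion, so the
  -- approximation property of `f` applies to it.
  obtain ⟨β, hβ⟩ := hf.exists_factor (h.isoClosure_of_shortExact hpb hX hf.1)
    (pullback.lift (i ≫ α) f (by rw [Category.assoc, hα, sq.w]))
  have hαβ : i ≫ α = f ≫ β ≫ pullback.fst q b := by
    rw [reassoc_of% hβ, pullback.lift_fst]
  let γ : E ⟶ Y := sq.desc α (β ≫ pullback.fst q b) hαβ
  have hγ : a ≫ γ = α := sq.inl_desc _ _ _
  -- `γ` is a section of `q` only along `a`, as `β ≫ pullback.snd q b` need not be the identity. The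
  -- error factors through `C₀` and lifts to `Y` because `Ext¹(C₀, X) = 0`.
  have hδ : a ≫ (𝟙 E - γ ≫ q) = 0 := by
    rw [Preadditive.comp_sub, reassoc_of% hγ, hα, Category.comp_id, sub_self]
  have : Epi (ShortComplex.mk a c hac).g := hepi
  obtain ⟨m, hm⟩ := (hC₀ X hX).exists_lift hS (hexc.desc _ hδ)
  have hcd : c ≫ hexc.desc _ hδ = 𝟙 E - γ ≫ q := hexc.g_desc _ hδ
  dsimp at hm
  refine ⟨γ + c ≫ m, ?_⟩
  rw [Preadditive.add_comp, Category.assoc c, hm, hcd, add_sub_cancel]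

/-! ### The two directions of the equivalence. -/

theorem IsTauCotorsionTorsionTriple.exists_leftApproximation [EnoughProjectives A]
    (h : IsTauCotorsionTorsionTriple C T F) (M : A) :
    ∃ (D₀ C₀ : A) (f : M ⟶ D₀) (p : D₀ ⟶ C₀) (hfp : f ≫ p = 0),
      (ShortComplex.mk f p hfp).Exact ∧ Epi p ∧ T D₀ ∧ C C₀ ∧ IsLeftApproximation T f := by
  obtain ⟨D₀, C₀, f, p, hfp, hex, hepi, ⟨-, hD₀⟩, hC₀, hf⟩ :=
    h.tauCotorsionPair.exists_exact (Projective.over M) inferInstance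
  -- Pushing out along an epimorphism keeps the cokernel of `f` and replaces `D₀` by a quotient,
  -- which is again torsion.
  have sq := IsPushout.of_hasPushout (Projective.π M) f
  have : Epi (pushout.inr (Projective.π M) f) := inferInstance
  obtain ⟨D₁, hD₁, ⟨e⟩⟩ := h.torsionPair.isoClosure_of_epi hD₀ (pushout.inr (Projective.π M) f)
  have sq' : IsPushout (Projective.π M) f (pushout.inl (Projective.π M) f ≫ e.hom)
      (pushout.inr (Projective.π M) f ≫ e.hom) :=
    sq.of_iso (Iso.refl _) (Iso.refl _) (Iso.refl _) e (by simp) (by simp) (by simp) (by simp)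
  obtain ⟨c, hc, -, hepi', hex'⟩ := exists_cokernel_of_isPushout sq' hfp hex
  refine ⟨D₁, C₀, _, c, hc, hex', hepi', hD₁, hC₀, hD₁, fun X hX g => ?_⟩
  obtain ⟨k, hk⟩ := hf.2 X hX (Projective.π M ≫ g)
  exact ⟨sq'.desc g k hk.symm, sq'.inl_desc _ _ _⟩

theorem IsTauCotorsionTorsionTriple.isLeftWeakCotorsionTorsionTriple [EnoughProjectives A]
    (h : IsTauCotorsionTorsionTriple C T F) : IsLeftWeakCotorsionTorsionTriple C T F where
  torsionPair := h.torsionPair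
  leftWeakCotorsionPair :=
    { ext_eq_zero := fun X Y hX hY => by
        rw [h.tauCotorsionPair.eq_leftPerpOne] at hX
        exact hX Y hY
      exists_exact := h.exists_leftApproximation
      exists_shortExact := fun M => by
        let S : ShortComplex A := ShortComplex.mk (kernel.ι (Projective.π M)) (Projective.π M)
          (kernel.condition _)
        have hS : S.ShortExact := ⟨ShortComplex.exact_of_f_is_kernel _ (kernelIsKernel _)⟩
        obtain ⟨D₀, C₀, f, p, hfp, hex, hepi, hD₀, hC₀, hf⟩ := h.exists_leftApproximation S.X₁
        have hC := h.tauCotorsionPair.eq_leftPerpOne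
        have sq := IsPushout.of_hasPushout S.f f
        have : Projective S.X₂ := inferInstanceAs (Projective (Projective.over M))
        have hE : C (pushout S.f f) := by
          rw [hC] at hC₀ ⊢
          exact leftPerpOne_of_isPushout h.torsionPair sq hfp hex hC₀ hf
        obtain ⟨g, hg, -, hse⟩ := shortExact_of_isPushout hS sq
        refine ⟨D₀, _, _, g, hg, hse, hD₀, hE, hE, fun X hX k => ?_⟩
        rw [hC] at hX
        exact (hX D₀ hD₀).exists_lift hse k }

/-- For `M` in `{}^{⊥₁} T` the special right approximation splits, so `M` is a retract of an object
of `C`. -/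
theorem IsLeftWeakCotorsionTorsionTriple.eq_leftPerpOne [C.IsStableUnderRetracts]
    (h : IsLeftWeakCotorsionTorsionTriple C T F) : C = leftPerpOne T := by
  ext M
  refine ⟨fun hM N hN => h.leftWeakCotorsionPair.ext_eq_zero M N hM hN, fun hM => ?_⟩
  obtain ⟨D₁, C₁, i, g, hig, hS, hD₁, hC₁, -⟩ := h.leftWeakCotorsionPair.exists_shortExact M
  obtain ⟨s, hs⟩ := (hM D₁ hD₁).exists_lift hS (𝟙 M)
  exact C.prop_of_retract ⟨s, g, hs⟩ hC₁

/-- Maps from torsion objects to `M` land in its torsion part `t`. The special right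
`C`-approximation of `t` has torsion kernel, so its source is an extension of torsion objects and
lies in `C ⊓ T` up to isomorphism. -/
theorem IsLeftWeakCotorsionTorsionTriple.isContravariantlyFinite [C.IsStableUnderRetracts]
    (h : IsLeftWeakCotorsionTorsionTriple C T F) : IsContravariantlyFinite (C ⊓ T) := by
  intro M
  obtain ⟨t, f, i, p, hip, hS, ht, hf⟩ := h.torsionPair.exists_shortExact M
  obtain ⟨D₁, C₁, j, g, hjg, hS', hD₁, hC₁, hg⟩ := h.leftWeakCotorsionPair.exists_shortExact t
  obtain ⟨X₀, hX₀, ⟨e⟩⟩ := h.torsionPair.isoClosure_of_shortExact hS' hD₁ ht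
  dsimp at e
  refine ⟨X₀, e.inv ≫ g ≫ i, ⟨C.prop_of_iso e hC₁, hX₀⟩, fun X hX k => ?_⟩
  have : Mono (ShortComplex.mk i p hip).f := hS.mono_f
  have hk : k ≫ p = 0 := h.torsionPair.hom_eq_zero X f hX.2 hf _
  have hl : hS.exact.lift k hk ≫ i = k := hS.exact.lift_f k hk
  obtain ⟨m, hm⟩ := hg.2 X hX.1 (hS.exact.lift k hk)
  exact ⟨m ≫ e.hom, by simp [reassoc_of% hm, hl]⟩

theorem IsLeftWeakCotorsionTorsionTriple.isTauCotorsionTorsionTriple [EnoughProjectives A]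
    [C.IsStableUnderRetracts] (h : IsLeftWeakCotorsionTorsionTriple C T F) :
    IsTauCotorsionTorsionTriple C T F where
  torsionPair := h.torsionPair
  tauCotorsionPair :=
    { eq_leftPerpOne := h.eq_leftPerpOne
      contravariantlyFinite := h.isContravariantlyFinite
      exists_exact := fun P hP => by
        obtain ⟨D₀, C₀, f, p, hfp, hex, hepi, hD₀, hC₀, hf⟩ :=
          h.leftWeakCotorsionPair.exists_exact P
        refine ⟨D₀, C₀, f, p, hfp, hex, hepi, ⟨?_, hD₀⟩, hC₀, hf⟩
        -- In this trivial square the pushout object is `D₀`, so the key lemma applies to `D₀`.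
        have sq : IsPushout (𝟙 P) f f (𝟙 D₀) := IsPushout.of_horiz_isIso ⟨by simp⟩
        rw [h.eq_leftPerpOne] at hC₀ ⊢
        exact leftPerpOne_of_isPushout h.torsionPair sq hfp hex hC₀ hf }

theorem isTauCotorsionTorsionTriple_iff [EnoughProjectives A] [C.IsStableUnderRetracts] :
    IsTauCotorsionTorsionTriple C T F ↔ IsLeftWeakCotorsionTorsionTriple C T F :=
  ⟨fun h => h.isLeftWeakCotorsionTorsionTriple, fun h => h.isTauCotorsionTorsionTriple⟩

end Abelian

/-! ### Enough projectives among finitely generated modules. -/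

section FGModuleCat

variable (k : Type u) [Ring k] [IsNoetherianRing k]

theorem projective_of_pi (n : ℕ) : Projective (FGModuleCat.of k (Fin n → k)) where
  factors {E X} f e he := by
    have : Epi ((forget₂ (FGModuleCat k) (ModuleCat.{u} k)).map e) := inferInstance
    have hsurj : Function.Surjective e.hom.hom := (ModuleCat.epi_iff_surjective _).1 this
    obtain ⟨l, hl⟩ := Module.projective_lifting_property e.hom.hom f.hom.hom hsurj
    exact ⟨FGModuleCat.ofHom l, FGModuleCat.hom_ext hl⟩

theorem enoughProjectives_fgModuleCat : EnoughProjectives (FGModuleCat.{u} k) where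
  presentation M := by
    obtain ⟨n, l, hl⟩ := Module.Finite.exists_fin' k M
    have hepi : Epi (FGModuleCat.ofHom l : FGModuleCat.of k (Fin n → k) ⟶ M) :=
      (forget₂ (FGModuleCat k) (ModuleCat.{u} k)).epi_of_epi_map
        ((ModuleCat.epi_iff_surjective _).2 hl)
    exact ⟨{ p := FGModuleCat.of k (Fin n → k)
             projective := projective_of_pi k n
             f := FGModuleCat.ofHom l
             epi := hepi }⟩

end FGModuleCat

end TauTriple

/-- Let `Λ` be an artin algebra over a commutative artinian ring `R`, and let `mod-Λ` be the
category of finitely generated right `Λ`-modules, i.e. of finitely generated `Λᵐᵒᵖ`-modules. -/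
theorem mainTheorem7 (R : Type w) [CommRing R] [IsArtinianRing R]
    (Λ : Type u) [Ring Λ] [Algebra R Λ] [Module.Finite R Λ]
    (C T F : ObjectProperty (FGModuleCat.{u} Λᵐᵒᵖ)) [C.IsStableUnderRetracts] :
    haveI : IsNoetherianRing Λᵐᵒᵖ := TauTriple.isNoetherianRing_op R Λ
    TauTriple.IsTauCotorsionTorsionTriple C T F ↔
      TauTriple.IsLeftWeakCotorsionTorsionTriple C T F := by
  have : IsNoetherianRing Λᵐᵒᵖ := TauTriple.isNoetherianRing_op R Λ
  have := TauTriple.enoughProjectives_fgModuleCat Λᵐᵒᵖ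
  exact TauTriple.isTauCotorsionTorsionTriple_iff
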